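/- **LT-M model.** Let $D=(V,E)$ be a finite directed graph with influence weights $b(u,v)\ge 0$ such that $\sum_u b(u,v)\le 1$ for every $v$, and meeting probabilities $m(u,v)\in[0,1]$; put $b(u,v)=m(u,v)=0$ if $(u,v)\notin E$. Every node $v$ draws a threshold $\theta_v$ uniformly from $[0,1]$, independently. At step $0$ the nodes of the seed set $S\subseteq V$ are activated. At every step $t\ge 1$ active nodes remain active, and every node $u$ that was activated before step $t$ meets each of its currently inactive out-neighbours $v$ with probability $m(u,v)$, independently of everything else; from the first such meeting on, the weight $b(u,v)$ is effective. An inactive node $v$ becomes active at step $t$ if the total effective weight of its in-neighbours (including the weights that become effective at step $t$) is at least $\theta_v$. Let $ap(v,t)$ be the probability that $v$ is activated exactly at step $t$. For a deadline $\tau\in\mathbb{N}$ let $\sigma_\tau(S)$ be the expected number of nodes that are active by the end of step $\tau$. **Theorem.** Let $D$ be acyclic and $S\subseteq V$. 1. For every $v\in V\setminus S$, every $\tau$ and every $1\le t\le\tau$, $$ap(v,t)=\sum_{u:\,(u,v)\in E} b(u,v)\sum_{t'=0}^{t-1} ap(u,t')\,m(u,v)\,(1-m(u,v))^{t-t'-1}\qquad(\text{with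 } 0^0=1).$$ 2. The activation probabilities and the influence spread can be computed exactly in time linear in the size of the graph: there are one program for a unit-cost random access machine with exact real arithmetic and a constant $C$ such that, for every acyclic $D$ (given as a list of edges, in any order, with their weights and meeting probabilities), every seed set $S$ and every deadline $\tau\in\mathbb{N}$, the program halts after at most $C\,(\tau+1)\,(|V|+|E|+1)$ steps and outputs $ap(v,t)$ for all $v\in V$ and $0\le t\le\tau$, together with $\sigma_\tau(S)$. -/

import Mathlib

open MeasureTheory ProbabilityTheory

/-! ## The Linear Threshold model with Meeting events -/

/-- A social network of the Linear Threshold model with Meeting events: a finite directed graph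
with edge set `E`, influence weights `b` whose sum over the in-edges of every node is at most `1`,
and meeting probabilities `m`; both vanish off the edges. -/
structure LTMNetwork (V : Type*) [Fintype V] where
  E : Finset (V × V)
  b : V → V → ℝ
  m : V → V → unitInterval
  b_nonneg : ∀ u v, 0 ≤ b u v
  sum_b_le_one : ∀ v, ∑ u, b u v ≤ 1
  b_eq_zero : ∀ u v, (u, v) ∉ E → b u v = 0
  m_eq_zero : ∀ u v, (u, v) ∉ E → m u v = 0

namespace LTMNetwork

/-- The graph has no directed cycle (in particular no self-loop). -/
def IsAcyclic {V : Type*} [Fintype V] (N : LTMNetwork V) : Prop :=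
  ∀ v, ¬ Relation.TransGen (fun x y => (x, y) ∈ N.E) v v

/-- The in-neighbours of `v`. -/
def inNbrs {V : Type*} [Fintype V] [DecidableEq V] (N : LTMNetwork V) (v : V) : Finset V :=
  Finset.univ.filter fun u => (u, v) ∈ N.E

/-- A configuration of the diffusion: the active nodes, and the edges whose influence weight is
effective. -/
structure Config (V : Type*) where
  active : Finset V
  effective : Finset (V × V)

/-- The edges whose weight is effective after one step, given the configuration before that step
and the outcomes `met` of the meetings during it: an edge from an active node to an inactive one
becomes effective when its end points meet, and stays effective. -/
def nextEffective {V : Type*} [Fintype V] [DecidableEq V] (N : LTMNetwork V)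
    (met : V × V → Bool) (c : Config V) : Finset (V × V) :=
  c.effective ∪ N.E.filter fun e => e.1 ∈ c.active ∧ e.2 ∉ c.active ∧ met e = true

/-- One step of the diffusion: active nodes remain active, and a node becomes active when the total
effective weight of its in-neighbours is at least its threshold. -/
noncomputable def step {V : Type*} [Fintype V] [DecidableEq V] (N : LTMNetwork V)
    (θ : V → ℝ) (met : V × V → Bool) (c : Config V) : Config V where
  active := c.active ∪ Finset.univ.filter fun v =>
    θ v ≤ ∑ u ∈ N.inNbrs v with (u, v) ∈ N.nextEffective met c, N.b u v
  effective := N.nextEffective met c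

/-- The sample space: the thresholds of the nodes, and for every time step and every pair of nodes
whether they meet at that step. -/
abbrev Sample (V : Type*) : Type _ := (V → ℝ) × (ℕ × (V × V) → Bool)

/-- The thresholds are uniform on `[0, 1]`, the pair `(u, v)` meets at each step with probability
`m u v`, and all of these are independent. -/
noncomputable def law {V : Type*} [Fintype V] (N : LTMNetwork V) : Measure (Sample V) :=
  (Measure.pi fun _ : V => (volume : Measure ℝ).restrict (Set.Icc 0 1)).prod
    (Measure.infinitePi fun i : ℕ × (V × V) => bernoulliMeasure true false (N.m i.2.1 i.2.2))

/-- The configuration at the end of step `t`, when the nodes of `S` are activated at step `0`. -/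
noncomputable def run {V : Type*} [Fintype V] [DecidableEq V] (N : LTMNetwork V)
    (S : Finset V) (ω : Sample V) : ℕ → Config V
  | 0 => ⟨S, ∅⟩
  | t + 1 => N.step ω.1 (fun e => ω.2 (t + 1, e)) (N.run S ω t)

/-- The activation probability: the probability that `v` is activated right at step `t`. -/
noncomputable def ap {V : Type*} [Fintype V] [DecidableEq V] (N : LTMNetwork V)
    (S : Finset V) (v : V) (t : ℕ) : ℝ :=
  N.law.real {ω | v ∈ (N.run S ω t).active ∧ ∀ s < t, v ∉ (N.run S ω s).active}

/-- The influence spread with deadline `τ`: the expected number of nodes that are active by the end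
of step `τ`. -/
noncomputable def influence {V : Type*} [Fintype V] [DecidableEq V] (N : LTMNetwork V)
    (S : Finset V) (τ : ℕ) : ℝ :=
  ∫ ω, ((N.run S ω τ).active.card : ℝ) ∂N.law

end LTMNetwork

/-! ## A unit-cost random access machine with real arithmetic

Programs are finite texts over finitely many arrays of natural numbers and of real numbers. There
are no real constants besides `0` and `1`, there is no conversion of reals into integers, and the
indices are computed by additions and truncated subtractions only. -/

namespace RealRAM

/-- The memory: natural-number arrays and real arrays, `nat a i` being entry `i` of array `a`. -/
structure Memory where
  nat : ℕ → ℕ → ℕ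
  real : ℕ → ℕ → ℝ

/-- Expressions with natural-number values; `get a i` reads entry `i` of the array `a`. -/
inductive NExpr where
  | const (k : ℕ)
  | get (a : ℕ) (i : NExpr)
  | add (x y : NExpr)
  | sub (x y : NExpr)

/-- Expressions with real values. -/
inductive RExpr where
  | zero
  | one
  | get (a : ℕ) (i : NExpr)
  | add (x y : RExpr)
  | sub (x y : RExpr)
  | mul (x y : RExpr)

def NExpr.eval (s : Memory) : NExpr → ℕ
  | .const k => k
  | .get a i => s.nat a (i.eval s)
  | .add x y => x.eval s + y.eval s
  | .sub x y => x.eval s - y.eval s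

/-- The number of unit-cost operations in an evaluation. -/
def NExpr.cost : NExpr → ℕ
  | .const _ => 1
  | .get _ i => i.cost + 1
  | .add x y => x.cost + y.cost + 1
  | .sub x y => x.cost + y.cost + 1

noncomputable def RExpr.eval (s : Memory) : RExpr → ℝ
  | .zero => 0
  | .one => 1
  | .get a i => s.real a (i.eval s)
  | .add x y => x.eval s + y.eval s
  | .sub x y => x.eval s - y.eval s
  | .mul x y => x.eval s * y.eval s

/-- The number of unit-cost operations in an evaluation. -/
def RExpr.cost : RExpr → ℕ
  | .zero => 1
  | .one => 1
  | .get _ i => i.cost + 1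
  | .add x y => x.cost + y.cost + 1
  | .sub x y => x.cost + y.cost + 1
  | .mul x y => x.cost + y.cost + 1

/-- Programs. The tests of branches and loops are comparisons `x < y` of natural numbers. -/
inductive Prog where
  | skip
  | setNat (a : ℕ) (i x : NExpr)
  | setReal (a : ℕ) (i : NExpr) (x : RExpr)
  | seq (p q : Prog)
  | ifLt (x y : NExpr) (p q : Prog)
  | whileLt (x y : NExpr) (p : Prog)

/-- Write `k` into entry `i` of the natural-number array `a`. -/
def Memory.writeNat (s : Memory) (a i k : ℕ) : Memory :=
  { s with nat := Function.update s.nat a (Function.update (s.nat a) i k) }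

/-- Write `r` into entry `i` of the real array `a`. -/
def Memory.writeReal (s : Memory) (a i : ℕ) (r : ℝ) : Memory :=
  { s with real := Function.update s.real a (Function.update (s.real a) i r) }

/-- `Exec p s k s'`: the program `p`, started in the memory `s`, halts after `k` steps with the
memory `s'`. -/
inductive Exec : Prog → Memory → ℕ → Memory → Prop where
  | skip (s : Memory) : Exec .skip s 1 s
  | setNat (s : Memory) (a : ℕ) (i x : NExpr) :
      Exec (.setNat a i x) s (i.cost + x.cost + 1) (s.writeNat a (i.eval s) (x.eval s))
  | setReal (s : Memory) (a : ℕ) (i : NExpr) (x : RExpr) :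
      Exec (.setReal a i x) s (i.cost + x.cost + 1) (s.writeReal a (i.eval s) (x.eval s))
  | seq {s s' s'' : Memory} {p q : Prog} {k l : ℕ} :
      Exec p s k s' → Exec q s' l s'' → Exec (.seq p q) s (k + l) s''
  | ifTrue {s s' : Memory} {x y : NExpr} {p q : Prog} {k : ℕ} :
      x.eval s < y.eval s → Exec p s k s' →
      Exec (.ifLt x y p q) s (x.cost + y.cost + 1 + k) s'
  | ifFalse {s s' : Memory} {x y : NExpr} {p q : Prog} {k : ℕ} :
      ¬ x.eval s < y.eval s → Exec q s k s' →
      Exec (.ifLt x y p q) s (x.cost + y.cost + 1 + k) s'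
  | whileTrue {s s' s'' : Memory} {x y : NExpr} {p : Prog} {k l : ℕ} :
      x.eval s < y.eval s → Exec p s k s' → Exec (.whileLt x y p) s' l s'' →
      Exec (.whileLt x y p) s (x.cost + y.cost + 1 + k + l) s''
  | whileFalse {s : Memory} {x y : NExpr} {p : Prog} :
      ¬ x.eval s < y.eval s → Exec (.whileLt x y p) s (x.cost + y.cost + 1) s

end RealRAM

/-- The input memory for a network on the nodes `0, …, n - 1` whose edges are listed, in an arbitrary
order, by `es`. Natural-number arrays: array `0` holds `n`, the number of edges and the deadline `τ`;
arrays `1` and `2` hold the tails and the heads of the edges; array `3` flags the seeds.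
Real arrays: arrays `0` and `1` hold the weights and the meeting probabilities of the edges.
All other entries are `0`. -/
noncomputable def LTMNetwork.input {n : ℕ} (N : LTMNetwork (Fin n)) (S : Finset (Fin n))
    (es : List (Fin n × Fin n)) (τ : ℕ) : RealRAM.Memory where
  nat a i :=
    match a with
    | 0 => match i with
      | 0 => n
      | 1 => es.length
      | 2 => τ
      | _ => 0
    | 1 => if h : i < es.length then (es[i].1 : ℕ) else 0
    | 2 => if h : i < es.length then (es[i].2 : ℕ) else 0
    | 3 => if h : i < n then (if (⟨i, h⟩ : Fin n) ∈ S then 1 else 0) else 0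
    | _ => 0
  real a i :=
    match a with
    | 0 => if h : i < es.length then N.b es[i].1 es[i].2 else 0
    | 1 => if h : i < es.length then (N.m es[i].1 es[i].2 : ℝ) else 0
    | _ => 0

/-! For a non-seed `v` with positive threshold, being active by step `t` is the same as having
threshold at most `metWeight`, the total weight of the in-neighbours that met `v` after their own
activation (`mem_active_iff_threshold_le`). Unlike effectiveness, `metBy` ignores the state of `v`,
so in a DAG this weight does not depend on the threshold of `v`. It lies in [0, 1], so the
probability that a uniform threshold is below it is its mean; by linearity, with no independence
between in-neighbours, this is the sum of `b u v` times the probability of `metBy`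
(`IsAcyclic.law_real_activeBy`). The increment of the latter is split by the activation time of `u`:
that time is independent of the meetings with `v`, and the wait for the first meeting is geometric
(`IsAcyclic.law_real_metBy_succ`). Differences in `t` give the recursion.

Independence is obtained by resampling: replacing a set of coordinates by those of an independent
copy preserves the law. An event blind to these coordinates and an event seeing only them pull back
to a rectangle.

For the algorithm, the inner sum of the recursion satisfies a one-term recurrence in `t`
(`edgeAcc_succ`), so each edge costs O(1) per time step. Step `t + 1` uses only values from step
`t`, so the edges can be scanned in any order, without a topological sort. Acyclicity matters only
for the probabilistic recursion. -/

/-! ## Mixing two independent samples of a product measure -/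

open Classical in
/-- The point with coordinates from `x.2` on `A` and from `x.1` off `A`. -/
noncomputable def mixOn {ι : Type*} {X : ι → Type*} (A : Set ι)
    (x : (∀ i, X i) × (∀ i, X i)) : ∀ i, X i :=
  fun i => if i ∈ A then x.2 i else x.1 i

section Mix

variable {ι : Type*} {X : ι → Type*}

theorem mixOn_of_mem {A : Set ι} {i : ι} (h : i ∈ A) (x : (∀ i, X i) × (∀ i, X i)) :
    mixOn A x i = x.2 i := if_pos h

theorem mixOn_of_notMem {A : Set ι} {i : ι} (h : i ∉ A) (x : (∀ i, X i) × (∀ i, X i)) :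
    mixOn A x i = x.1 i := if_neg h

variable [∀ i, MeasurableSpace (X i)]

theorem measurable_mixOn (A : Set ι) : Measurable (mixOn (X := X) A) := by
  refine measurable_pi_lambda _ fun i => ?_
  by_cases h : i ∈ A
  · simp only [mixOn_of_mem h]; fun_prop
  · simp only [mixOn_of_notMem h]; fun_prop

variable (μ : ∀ i, Measure (X i)) [∀ i, IsProbabilityMeasure (μ i)]

/-- The preimage of a cylinder is a product of two cylinders, one over the indices off `A` and one
over those in `A`, and the two finite products multiply back to the full one. -/
theorem measurePreserving_mixOn_infinitePi (A : Set ι) :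
    MeasurePreserving (mixOn A) ((Measure.infinitePi μ).prod (Measure.infinitePi μ))
      (Measure.infinitePi μ) := by
  classical
  refine ⟨measurable_mixOn A, Measure.eq_infinitePi _ fun s t ht => ?_⟩
  rw [Measure.map_apply (measurable_mixOn A)
    (MeasurableSet.pi s.countable_toSet fun i _ => ht i)]
  have : mixOn A ⁻¹' (Set.pi s t) =
      (Set.pi (s.filter (· ∉ A)) t) ×ˢ (Set.pi (s.filter (· ∈ A)) t) := by
    ext x
    simp only [Set.mem_preimage, Set.mem_pi, Set.mem_prod, SetLike.mem_coe, Finset.mem_filter]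
    constructor
    · intro h
      exact ⟨fun i hi => mixOn_of_notMem hi.2 x ▸ h i hi.1,
        fun i hi => mixOn_of_mem hi.2 x ▸ h i hi.1⟩
    · rintro ⟨h1, h2⟩ i hi
      by_cases h : i ∈ A
      · rw [mixOn_of_mem h]; exact h2 i ⟨hi, h⟩
      · rw [mixOn_of_notMem h]; exact h1 i ⟨hi, h⟩
  rw [this, Measure.prod_prod, Measure.infinitePi_pi _ fun i _ => ht i,
    Measure.infinitePi_pi _ fun i _ => ht i, mul_comm, Finset.prod_filter_mul_prod_filter_not]

theorem measurePreserving_mixOn_pi [Fintype ι] (A : Set ι) :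
    MeasurePreserving (mixOn A) ((Measure.pi μ).prod (Measure.pi μ)) (Measure.pi μ) := by
  simpa only [Measure.infinitePi_eq_pi] using measurePreserving_mixOn_infinitePi μ A

end Mix

/-- Regroups two samples by kind, thresholds with thresholds and meetings with meetings, so that
each factor of the law can be mixed separately. -/
theorem measurePreserving_prod_swap_inner {α β : Type*} [MeasurableSpace α] [MeasurableSpace β]
    (μ : Measure α) (ν : Measure β) [SFinite μ] [SFinite ν] :
    MeasurePreserving (fun x : (α × β) × (α × β) => ((x.1.1, x.2.1), (x.1.2, x.2.2)))
      ((μ.prod ν).prod (μ.prod ν)) ((μ.prod μ).prod (ν.prod ν)) := by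
  have h1 := measurePreserving_prodAssoc μ ν (μ.prod ν)
  have h2 := (MeasurePreserving.id μ).prod ((measurePreserving_prodAssoc ν μ ν).symm)
  have h3 := (MeasurePreserving.id μ).prod
    ((Measure.measurePreserving_swap (μ := ν) (ν := μ)).prod (MeasurePreserving.id ν))
  have h4 := (MeasurePreserving.id μ).prod (measurePreserving_prodAssoc μ ν ν)
  have h5 := (measurePreserving_prodAssoc μ μ (ν.prod ν)).symm
  exact h5.comp (h4.comp (h3.comp (h2.comp h1)))

/-! ### Independence and explicit probabilities under the law of the sample -/

namespace LTMNetwork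

variable {V : Type*}

/-- The event that `u` does not meet `v` at the steps after `a` up to `t`, but does at step
`t + 1`. -/
def firstMeeting (u v : V) (a t : ℕ) : Set (Sample V) :=
  {ω | (∀ s, a ≤ s → s < t → ω.2 (s + 1, (u, v)) = false) ∧ ω.2 (t + 1, (u, v)) = true}

theorem measurableSet_meeting (i : ℕ × (V × V)) (b : Bool) :
    MeasurableSet {ω : Sample V | ω.2 i = b} :=
  measurableSet_eq_fun (by fun_prop) measurable_const

theorem measurableSet_firstMeeting (u v : V) (a t : ℕ) :
    MeasurableSet (firstMeeting u v a t) := by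
  have : firstMeeting u v a t = (⋂ s ∈ Finset.Ico a t, {ω | ω.2 (s + 1, (u, v)) = false}) ∩
      {ω | ω.2 (t + 1, (u, v)) = true} := by
    ext; simp [firstMeeting]
  rw [this]
  exact (Finset.measurableSet_biInter _ fun s _ => measurableSet_meeting _ _).inter
    (measurableSet_meeting _ _)

variable [Fintype V]

theorem isProbabilityMeasure_volume_Icc :
    IsProbabilityMeasure ((volume : Measure ℝ).restrict (Set.Icc 0 1)) :=
  ⟨by simp⟩

attribute [local instance] isProbabilityMeasure_volume_Icc

instance (N : LTMNetwork V) : IsProbabilityMeasure N.law := by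
  unfold law; infer_instance

/-- The sample with the thresholds on `A` and the meetings on `B` taken from `x.2`, and all others
from `x.1`. -/
noncomputable def mixSample (A : Set V) (B : Set (ℕ × (V × V))) (x : Sample V × Sample V) :
    Sample V :=
  (mixOn A (x.1.1, x.2.1), mixOn B (x.1.2, x.2.2))

theorem measurePreserving_mixSample (N : LTMNetwork V) (A : Set V) (B : Set (ℕ × (V × V))) :
    MeasurePreserving (mixSample A B) (N.law.prod N.law) N.law := by
  have h := measurePreserving_prod_swap_inner
    (Measure.pi fun _ : V => (volume : Measure ℝ).restrict (Set.Icc 0 1))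
    (Measure.infinitePi fun i : ℕ × (V × V) => bernoulliMeasure true false (N.m i.2.1 i.2.2))
  exact ((measurePreserving_mixOn_pi _ A).prod (measurePreserving_mixOn_infinitePi _ B)).comp h

/-- Events that depend on disjoint sets of coordinates are independent. -/
theorem law_real_inter (N : LTMNetwork V) (A : Set V) (B : Set (ℕ × (V × V)))
    {s t : Set (Sample V)} (hs : MeasurableSet s) (ht : MeasurableSet t)
    (hsi : ∀ x, mixSample A B x ∈ s ↔ x.1 ∈ s) (hti : ∀ x, mixSample A B x ∈ t ↔ x.2 ∈ t) :
    N.law.real (s ∩ t) = N.law.real s * N.law.real t := by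
  have h := (N.measurePreserving_mixSample A B).measureReal_preimage (hs.inter ht).nullMeasurableSet
  have h2 : mixSample A B ⁻¹' (s ∩ t) = s ×ˢ t := by
    ext x; simp [hsi, hti]
  rw [← h, h2, measureReal_prod_prod]

theorem law_threshold_le (N : LTMNetwork V) (v : V) {x : ℝ} (h1 : x ≤ 1) :
    N.law {ω | ω.1 v ≤ x} = ENNReal.ofReal x := by
  have h2 : {ω : Sample V | ω.1 v ≤ x} = ((fun θ : V → ℝ => θ v) ⁻¹' Set.Iic x) ×ˢ Set.univ := by
    ext; simp
  rw [h2, law, Measure.prod_prod, measure_univ, mul_one,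
    (measurePreserving_eval (fun _ : V => (volume : Measure ℝ).restrict (Set.Icc 0 1)) v).measure_preimage
      measurableSet_Iic.nullMeasurableSet, Measure.restrict_apply measurableSet_Iic]
  -- A negative `x` is included: both sides are empty, and `ENNReal.ofReal` truncates to 0.
  have : Set.Iic x ∩ Set.Icc 0 1 = Set.Icc 0 x := by
    ext y; simp only [Set.mem_inter_iff, Set.mem_Iic, Set.mem_Icc]
    constructor
    · rintro ⟨a, b, c⟩; exact ⟨b, a⟩
    · rintro ⟨a, b⟩; exact ⟨b, a, b.trans h1⟩
  rw [this, Real.volume_Icc, sub_zero]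

theorem ae_threshold_pos (N : LTMNetwork V) (v : V) : ∀ᵐ ω ∂N.law, 0 < ω.1 v := by
  have := N.law_threshold_le v zero_le_one
  rw [ENNReal.ofReal_zero] at this
  simpa [ae_iff] using this

/-- The threshold of `v` is at most a quantity independent of it with probability the mean of that
quantity. -/
theorem law_real_threshold_le (N : LTMNetwork V) (v : V) {f : Sample V → ℝ} (hf : Measurable f)
    (h0 : ∀ ω, 0 ≤ f ω) (h1 : ∀ ω, f ω ≤ 1) (hfi : ∀ x, f (mixSample {v} ∅ x) = f x.1) :
    N.law.real {ω | ω.1 v ≤ f ω} = ∫ ω, f ω ∂N.law := by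
  have hm : MeasurableSet {ω : Sample V | ω.1 v ≤ f ω} := measurableSet_le (by fun_prop) hf
  have h := (N.measurePreserving_mixSample {v} ∅).measure_preimage hm.nullMeasurableSet
  have h2 : N.law {ω | ω.1 v ≤ f ω} = ∫⁻ ω, ENNReal.ofReal (f ω) ∂N.law := by
    -- Fubini: with the first sample fixed, `f` is a constant and only the threshold of `v` is drawn
    -- afresh.
    rw [← h, Measure.prod_apply ((N.measurePreserving_mixSample {v} ∅).measurable hm)]
    refine lintegral_congr fun ω => ?_
    rw [← N.law_threshold_le v (h1 ω)]
    congr 1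
    ext ω'
    simp only [Set.mem_preimage, Set.mem_ofPred_eq, hfi]
    exact Iff.of_eq (congrArg (· ≤ f ω) (mixOn_of_mem (Set.mem_singleton v) _))
  rw [measureReal_def, h2, integral_eq_lintegral_of_nonneg_ae (.of_forall h0)
    hf.aestronglyMeasurable]

theorem law_real_firstMeeting (N : LTMNetwork V) (u v : V) {a t : ℕ} (hat : a ≤ t) :
    N.law.real (firstMeeting u v a t) = (N.m u v : ℝ) * (1 - N.m u v) ^ (t - a) := by
  classical
  obtain ⟨f, hf⟩ : ∃ f : ℕ ↪ ℕ × (V × V), ∀ s, f s = (s + 1, (u, v)) :=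
    ⟨⟨fun s => (s + 1, (u, v)), fun x y h => by simpa using h⟩, fun _ => rfl⟩
  -- The event is a cylinder over the steps `a + 1, …, t + 1`: failures, then one success at the
  -- last.
  set T : ℕ × (V × V) → Set Bool := fun i => if i.1 = t + 1 then {true} else {false} with hT
  have h2 : firstMeeting u v a t = Set.univ ×ˢ Set.pi ((Finset.Icc a t).map f) T := by
    ext ω
    simp only [firstMeeting, Set.mem_ofPred_eq, Set.mem_prod, Set.mem_univ, true_and, Set.mem_pi,
      SetLike.mem_coe, Finset.mem_map, Finset.mem_Icc, forall_exists_index, and_imp]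
    constructor
    · rintro ⟨h1, h2⟩ i s has hst rfl
      rcases hst.lt_or_eq with h | rfl
      · simpa [hT, hf, h.ne] using h1 s has h
      · simpa [hT, hf] using h2
    · intro h
      refine ⟨fun s has hst => ?_, ?_⟩
      · simpa [hT, hf, hst.ne] using h _ s has hst.le rfl
      · simpa [hT, hf] using h _ t hat le_rfl rfl
  rw [h2, law, measureReal_prod_prod, probReal_univ, one_mul, measureReal_def,
    Measure.infinitePi_pi _ fun i _ => .of_discrete, Finset.prod_map, ENNReal.toReal_prod,
    ← Finset.Ico_insert_right hat, Finset.prod_insert Finset.right_notMem_Ico]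
  congr 1
  · rw [hf]; simp [hT]
  · rw [Finset.prod_congr rfl (g := fun _ => 1 - (N.m u v : ℝ)), Finset.prod_const, Nat.card_Ico]
    intro s hs
    have : s ≠ t := (Finset.mem_Ico.1 hs).2.ne
    rw [hf]; simp [hT, this]

end LTMNetwork

namespace LTMNetwork

variable {V : Type*} [Fintype V] [DecidableEq V] (N : LTMNetwork V) (S : Finset V)

/-! ## The diffusion for a fixed sample -/

/-- The event that `v` is active at the end of step `t`. -/
def activeBy (v : V) (t : ℕ) : Set (Sample V) := {ω | v ∈ (N.run S ω t).active}

/-- The event that `v` is activated right at step `t`. -/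
def activatedAt (v : V) (t : ℕ) : Set (Sample V) :=
  {ω | v ∈ (N.run S ω t).active ∧ ∀ s < t, v ∉ (N.run S ω s).active}

/-- The event that `u` meets `v` by step `t`, after having been activated. -/
def metBy (u v : V) (t : ℕ) : Set (Sample V) :=
  {ω | ∃ s < t, u ∈ (N.run S ω s).active ∧ ω.2 (s + 1, (u, v)) = true}

/-- The total weight of the in-neighbours of `v` that have met `v` by step `t`. -/
noncomputable def metWeight (v : V) (t : ℕ) (ω : Sample V) : ℝ :=
  ∑ u ∈ N.inNbrs v, (N.metBy S u v t).indicator (fun _ => N.b u v) ω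

variable {N S}

theorem mem_inNbrs {u v : V} : u ∈ N.inNbrs v ↔ (u, v) ∈ N.E := by simp [inNbrs]

theorem mem_active_succ {ω : Sample V} {v : V} {t : ℕ} :
    v ∈ (N.run S ω (t + 1)).active ↔ v ∈ (N.run S ω t).active ∨
      ω.1 v ≤ ∑ u ∈ N.inNbrs v with (u, v) ∈ (N.run S ω (t + 1)).effective, N.b u v := by
  simp only [run, step, Finset.mem_union, Finset.mem_filter, Finset.mem_univ, true_and]
  rfl

theorem mem_effective_succ {ω : Sample V} {u v : V} {t : ℕ} :
    (u, v) ∈ (N.run S ω (t + 1)).effective ↔ (u, v) ∈ (N.run S ω t).effective ∨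
      (u, v) ∈ N.E ∧ u ∈ (N.run S ω t).active ∧ v ∉ (N.run S ω t).active ∧
        ω.2 (t + 1, (u, v)) = true := by
  simp [run, step, nextEffective]

theorem active_mono (ω : Sample V) : Monotone fun t => (N.run S ω t).active :=
  monotone_nat_of_le_succ fun _ _ h => mem_active_succ.2 (.inl h)

theorem metBy_mono (u v : V) : Monotone (N.metBy S u v) :=
  fun _ _ h _ ⟨s, hs, h'⟩ => ⟨s, hs.trans_le h, h'⟩

theorem mem_metBy_succ {ω : Sample V} {u v : V} {t : ℕ} :
    ω ∈ N.metBy S u v (t + 1) ↔ ω ∈ N.metBy S u v t ∨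
      u ∈ (N.run S ω t).active ∧ ω.2 (t + 1, (u, v)) = true := by
  constructor
  · rintro ⟨s, hs, h⟩
    rcases (Nat.lt_succ_iff.1 hs).lt_or_eq with h' | rfl
    · exact .inl ⟨s, h', h⟩
    · exact .inr h
  · rintro (h | h)
    · exact metBy_mono u v t.le_succ h
    · exact ⟨t, t.lt_succ_self, h⟩

/-- The two notions differ only in whether the head must be inactive at the meeting, which is
automatic before its activation. -/
theorem mem_effective_iff_mem_metBy {ω : Sample V} {u v : V} (huv : (u, v) ∈ N.E) {t : ℕ}
    (hv : ∀ s < t, v ∉ (N.run S ω s).active) :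
    (u, v) ∈ (N.run S ω t).effective ↔ ω ∈ N.metBy S u v t := by
  induction t with
  | zero => simp [run, metBy]
  | succ t ih =>
    rw [mem_effective_succ, mem_metBy_succ, ih fun s hs => hv s (hs.trans t.lt_succ_self)]
    simp [huv, hv t t.lt_succ_self]

theorem metWeight_mono (v : V) (ω : Sample V) : Monotone fun t => N.metWeight S v t ω :=
  fun _ _ h => Finset.sum_le_sum fun u _ =>
    Set.indicator_le_indicator_of_subset (metBy_mono u v h) (fun _ => N.b_nonneg u v) ω

theorem metWeight_nonneg (v : V) (t : ℕ) (ω : Sample V) : 0 ≤ N.metWeight S v t ω :=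
  Finset.sum_nonneg fun _ _ => Set.indicator_nonneg (fun _ _ => N.b_nonneg _ _) _

theorem metWeight_le_one (v : V) (t : ℕ) (ω : Sample V) : N.metWeight S v t ω ≤ 1 := by
  refine le_trans ?_ (N.sum_b_le_one v)
  refine (Finset.sum_le_sum fun u _ =>
    Set.indicator_le_self' (fun _ _ => N.b_nonneg u v) ω).trans ?_
  exact Finset.sum_le_sum_of_subset_of_nonneg (Finset.subset_univ _) fun u _ _ => N.b_nonneg u v

/-- A node with positive threshold is active iff enough weight has met it. -/
theorem mem_active_iff_threshold_le {ω : Sample V} {v : V} (hv : v ∉ S) (hω : 0 < ω.1 v) (t : ℕ) :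
    v ∈ (N.run S ω t).active ↔ ω.1 v ≤ N.metWeight S v t ω := by
  induction t with
  -- Positivity of the threshold is needed here: no weight has arrived at step 0, and a threshold 0
  -- would already be met.
  | zero => simp [run, hv, metWeight, metBy, hω]
  | succ t ih =>
    rw [mem_active_succ]
    by_cases h : v ∈ (N.run S ω t).active
    · simpa [h] using (ih.1 h).trans (metWeight_mono v ω t.le_succ)
    · have h' : ∀ s < t + 1, v ∉ (N.run S ω s).active := fun s hs hs' =>
        h (active_mono ω (Nat.lt_succ_iff.1 hs) hs')
      have : ∑ u ∈ N.inNbrs v with (u, v) ∈ (N.run S ω (t + 1)).effective, N.b u v =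
          N.metWeight S v (t + 1) ω := by
        classical
        rw [Finset.sum_filter]
        refine Finset.sum_congr rfl fun u hu => ?_
        rw [Set.indicator_apply]
        exact if_congr (mem_effective_iff_mem_metBy (mem_inNbrs.1 hu) h') rfl rfl
      rw [this]
      simp [h]

/-- In an arbitrary graph, the diffusion at the nodes not reachable from `v` depends neither on the
threshold of `v` nor on the meetings with `v` of its in-neighbours. -/
theorem run_congr_of_not_reachable {v : V} {ω ω' : Sample V} (h1 : ∀ x ≠ v, ω.1 x = ω'.1 x)
    (h2 : ∀ s x, ∀ y ≠ v, ω.2 (s, (x, y)) = ω'.2 (s, (x, y))) (t : ℕ) (w : V)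
    (hw : ¬ Relation.ReflTransGen (fun x y => (x, y) ∈ N.E) v w) :
    (w ∈ (N.run S ω t).active ↔ w ∈ (N.run S ω' t).active) ∧
      ∀ u, (u, w) ∈ (N.run S ω t).effective ↔ (u, w) ∈ (N.run S ω' t).effective := by
  have hne {w : V} (hw : ¬ Relation.ReflTransGen (fun x y => (x, y) ∈ N.E) v w) : w ≠ v := by
    rintro rfl; exact hw .refl
  induction t generalizing w with
  | zero => simp [run]
  | succ t ih =>
    have he : ∀ u, (u, w) ∈ (N.run S ω (t + 1)).effective ↔
        (u, w) ∈ (N.run S ω' (t + 1)).effective := by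
      intro u
      rw [mem_effective_succ, mem_effective_succ, (ih w hw).2 u, (ih w hw).1, h2 _ _ w (hne hw)]
      -- A tail `u` of an edge into `w` is itself unreachable from `v`, so the induction hypothesis
      -- applies to it.
      refine or_congr_right (and_congr_right fun huw => and_congr_left fun _ => ?_)
      exact (ih u fun h => hw (h.tail huw)).1
    refine ⟨?_, he⟩
    rw [mem_active_succ, mem_active_succ, (ih w hw).1, h1 w (hne hw)]
    simp only [he]

/-- A path from `v` to its in-neighbour `u` would close a cycle, so `u` is blind to the resampled
coordinates. -/
theorem IsAcyclic.mem_active_mixSample (hN : N.IsAcyclic) {u v : V} (huv : (u, v) ∈ N.E)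
    {B : Set (ℕ × (V × V))} (hB : ∀ i ∈ B, i.2.2 = v) (x : Sample V × Sample V) (t : ℕ) :
    u ∈ (N.run S (mixSample {v} B x) t).active ↔ u ∈ (N.run S x.1 t).active := by
  refine (run_congr_of_not_reachable ?_ ?_ t u fun h => hN v (.tail' h huv)).1
  · exact fun w hw => mixOn_of_notMem (A := {v}) hw _
  · exact fun s a w hw => mixOn_of_notMem (A := B) (fun h => hw (hB _ h)) _

/-! ## Measurability -/

theorem measurableSet_active_and_effective (t : ℕ) :
    (∀ v, MeasurableSet (N.activeBy S v t)) ∧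
      ∀ u v, MeasurableSet {ω | (u, v) ∈ (N.run S ω t).effective} := by
  induction t with
  | zero => simp [activeBy, run]
  | succ t ih =>
    have he : ∀ u v, MeasurableSet {ω | (u, v) ∈ (N.run S ω (t + 1)).effective} := by
      intro u v
      simp only [mem_effective_succ]
      exact (ih.2 u v).union ((MeasurableSet.const _).inter ((ih.1 u).inter
        ((ih.1 v).compl.inter (measurableSet_meeting _ _))))
    refine ⟨fun v => ?_, he⟩
    simp only [activeBy, mem_active_succ, Finset.sum_filter]
    refine (ih.1 v).union (measurableSet_le ((measurable_pi_apply v).comp measurable_fst) ?_)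
    exact Finset.measurable_sum _ fun u _ =>
      Measurable.ite (he u v) measurable_const measurable_const

theorem measurableSet_activeBy (v : V) (t : ℕ) : MeasurableSet (N.activeBy S v t) :=
  (measurableSet_active_and_effective t).1 v

theorem measurableSet_activatedAt (v : V) (t : ℕ) : MeasurableSet (N.activatedAt S v t) := by
  have : N.activatedAt S v t =
      N.activeBy S v t ∩ ⋂ s ∈ Finset.range t, (N.activeBy S v s)ᶜ := by
    ext; simp [activatedAt, activeBy]
  rw [this]
  exact (measurableSet_activeBy v t).inter
    (Finset.measurableSet_biInter _ fun s _ => (measurableSet_activeBy v s).compl)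

theorem measurableSet_metBy (u v : V) (t : ℕ) : MeasurableSet (N.metBy S u v t) := by
  induction t with
  | zero => simp [metBy]
  | succ t ih =>
    have : N.metBy S u v (t + 1) = N.metBy S u v t ∪
        (N.activeBy S u t ∩ {ω | ω.2 (t + 1, (u, v)) = true}) := by
      ext; simp [mem_metBy_succ, activeBy]
    rw [this]
    exact ih.union ((measurableSet_activeBy u t).inter (measurableSet_meeting _ _))

/-! ## The activation probabilities -/

theorem disjoint_activatedAt {u : V} {s t : ℕ} (h : s ≠ t) :
    Disjoint (N.activatedAt S u s) (N.activatedAt S u t) := by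
  rw [Set.disjoint_left]
  rintro ω ⟨h1, h2⟩ ⟨h3, h4⟩
  rcases h.lt_or_gt with h | h
  · exact h4 s h h1
  · exact h2 t h h3

theorem exists_mem_activatedAt {ω : Sample V} {u : V} {t : ℕ} (h : u ∈ (N.run S ω t).active) :
    ∃ s ≤ t, ω ∈ N.activatedAt S u s := by
  classical
  have hex : ∃ s, u ∈ (N.run S ω s).active := ⟨t, h⟩
  exact ⟨Nat.find hex, Nat.find_min' hex h, Nat.find_spec hex, fun s hs => Nat.find_min hex hs⟩

theorem activeBy_eq_biUnion (v : V) (t : ℕ) :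
    N.activeBy S v t = ⋃ s ∈ Finset.range (t + 1), N.activatedAt S v s := by
  ext ω
  simp only [Set.mem_iUnion, Finset.mem_range, Nat.lt_succ_iff, exists_prop]
  exact ⟨exists_mem_activatedAt, fun ⟨s, hs, h⟩ => active_mono ω hs h.1⟩

theorem law_real_activeBy (v : V) (t : ℕ) :
    N.law.real (N.activeBy S v t) = ∑ s ∈ Finset.range (t + 1), N.ap S v s := by
  rw [activeBy_eq_biUnion, measureReal_biUnion_finset
    (fun _ _ _ _ h => disjoint_activatedAt h) fun s _ => measurableSet_activatedAt v s]
  rfl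

theorem ap_zero (v : V) : N.ap S v 0 = if v ∈ S then 1 else 0 := by
  by_cases h : v ∈ S <;> simp [ap, run, h]

theorem ap_succ_of_mem {v : V} (hv : v ∈ S) (t : ℕ) : N.ap S v (t + 1) = 0 := by
  have : {ω | v ∈ (N.run S ω (t + 1)).active ∧ ∀ s < t + 1, v ∉ (N.run S ω s).active} = ∅ :=
    Set.eq_empty_of_forall_notMem fun ω h => h.2 0 t.succ_pos hv
  rw [ap, this, measureReal_empty]

theorem influence_eq_sum_ap (τ : ℕ) :
    N.influence S τ = ∑ t ∈ Finset.range (τ + 1), ∑ v, N.ap S v t := by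
  have (ω : Sample V) : ((N.run S ω τ).active.card : ℝ) =
      ∑ v, (N.activeBy S v τ).indicator (fun _ => (1 : ℝ)) ω := by
    classical
    simp [Set.indicator_apply, activeBy]
  simp only [influence, this]
  rw [integral_finsetSum _ fun v _ =>
    (integrable_const (1 : ℝ)).indicator (measurableSet_activeBy v τ), Finset.sum_comm]
  refine Finset.sum_congr rfl fun v _ => ?_
  rw [integral_indicator_const _ (measurableSet_activeBy v τ), smul_eq_mul, mul_one,
    law_real_activeBy]

/-- Meetings before the activation of `u` do not count, so the first one that counts is described by
the activation time `s` and the meetings after it. -/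
theorem metBy_succ_diff (u v : V) (t : ℕ) :
    N.metBy S u v (t + 1) \ N.metBy S u v t =
      ⋃ s ∈ Finset.range (t + 1), N.activatedAt S u s ∩ firstMeeting u v s t := by
  ext ω
  simp only [Set.mem_iUnion, Finset.mem_range, Nat.lt_succ_iff, exists_prop, Set.mem_sdiff,
    mem_metBy_succ]
  constructor
  · rintro ⟨h1, h2⟩
    obtain ⟨h3, h4⟩ := h1.resolve_left h2
    obtain ⟨s, hs, h5⟩ := exists_mem_activatedAt h3
    refine ⟨s, hs, h5, fun r hsr hrt => ?_, h4⟩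
    by_contra h6
    exact h2 ⟨r, hrt, active_mono ω hsr h5.1, by simpa using h6⟩
  · rintro ⟨s, hs, ⟨h1, h2⟩, h3, h4⟩
    refine ⟨.inr ⟨active_mono ω hs h1, h4⟩, ?_⟩
    rintro ⟨r, hrt, h5, h6⟩
    rcases lt_or_ge r s with h | h
    · exact h2 r h h5
    · simp [h3 r h hrt] at h6

/-- All meetings with head `v` are resampled: the activation of `u` ignores them, and the first
meeting sees nothing else. -/
theorem IsAcyclic.law_real_activatedAt_inter (hN : N.IsAcyclic) {u v : V} (huv : (u, v) ∈ N.E)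
    {s t : ℕ} (hst : s ≤ t) :
    N.law.real (N.activatedAt S u s ∩ firstMeeting u v s t) =
      N.ap S u s * ((N.m u v : ℝ) * (1 - N.m u v) ^ (t - s)) := by
  rw [N.law_real_inter {v} {i | i.2.2 = v} (measurableSet_activatedAt u s)
    (measurableSet_firstMeeting u v s t), N.law_real_firstMeeting u v hst]
  · rfl
  · intro x
    simp only [activatedAt, Set.mem_ofPred_eq,
      hN.mem_active_mixSample huv (B := {i | i.2.2 = v}) fun _ h => h]
  · intro x
    have : ∀ r, (mixSample {v} {i | i.2.2 = v} x).2 (r, (u, v)) = x.2.2 (r, (u, v)) := fun r =>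
      mixOn_of_mem (A := {i : ℕ × (V × V) | i.2.2 = v}) (i := (r, (u, v))) rfl (x.1.2, x.2.2)
    simp only [firstMeeting, Set.mem_ofPred_eq, this]

theorem IsAcyclic.law_real_metBy_succ (hN : N.IsAcyclic) {u v : V} (huv : (u, v) ∈ N.E) (t : ℕ) :
    N.law.real (N.metBy S u v (t + 1)) = N.law.real (N.metBy S u v t) +
      ∑ s ∈ Finset.range (t + 1), N.ap S u s * (N.m u v : ℝ) * (1 - N.m u v) ^ (t - s) := by
  have h := measureReal_sdiff_add_inter (μ := N.law) (s := N.metBy S u v (t + 1))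
    (measurableSet_metBy (N := N) (S := S) u v t)
  rw [Set.inter_eq_right.2 (metBy_mono u v t.le_succ), metBy_succ_diff,
    measureReal_biUnion_finset (fun _ _ _ _ h =>
      (disjoint_activatedAt h).mono Set.inter_subset_left Set.inter_subset_left)
      fun s _ => (measurableSet_activatedAt u s).inter (measurableSet_firstMeeting u v s t)] at h
  rw [← h, add_comm]
  congr 1
  refine Finset.sum_congr rfl fun s hs => ?_
  rw [hN.law_real_activatedAt_inter huv (Nat.lt_succ_iff.1 (Finset.mem_range.1 hs)), mul_assoc]

theorem IsAcyclic.law_real_activeBy (hN : N.IsAcyclic) {v : V} (hv : v ∉ S) (t : ℕ) :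
    N.law.real (N.activeBy S v t) =
      ∑ u ∈ N.inNbrs v, N.b u v * N.law.real (N.metBy S u v t) := by
  have h1 : N.law.real (N.activeBy S v t) = N.law.real {ω | ω.1 v ≤ N.metWeight S v t ω} := by
    refine measureReal_congr ?_
    filter_upwards [N.ae_threshold_pos v] with ω hω
    exact propext (mem_active_iff_threshold_le hv hω t)
  rw [h1, N.law_real_threshold_le v _ (metWeight_nonneg v t) (metWeight_le_one v t)]
  · simp only [metWeight]
    rw [integral_finsetSum _ fun u _ =>
      (integrable_const (N.b u v)).indicator (measurableSet_metBy u v t)]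
    refine Finset.sum_congr rfl fun u _ => ?_
    rw [integral_indicator_const _ (measurableSet_metBy u v t), smul_eq_mul, mul_comm]
  -- Only the threshold of `v` is resampled; the weight does depend on the meetings with `v`.
  · intro x
    refine Finset.sum_congr rfl fun u hu => ?_
    have : mixSample {v} ∅ x ∈ N.metBy S u v t ↔ x.1 ∈ N.metBy S u v t := by
      have : ∀ i, (mixSample {v} ∅ x).2 i = x.1.2 i := fun i =>
        mixOn_of_notMem (Set.notMem_empty i) _
      simp only [metBy, Set.mem_ofPred_eq, this,
        hN.mem_active_mixSample (mem_inNbrs.1 hu) (B := ∅) (by simp)]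
    classical
    simp only [Set.indicator_apply, this]
  · exact Finset.measurable_sum _ fun u _ =>
      measurable_const.indicator (measurableSet_metBy u v t)

/-- The recursion for the activation probabilities. -/
theorem IsAcyclic.ap_succ (hN : N.IsAcyclic) {v : V} (hv : v ∉ S) (t : ℕ) :
    N.ap S v (t + 1) = ∑ u ∈ N.inNbrs v, N.b u v *
      ∑ s ∈ Finset.range (t + 1), N.ap S u s * (N.m u v : ℝ) * (1 - N.m u v) ^ (t - s) := by
  have h1 := LTMNetwork.law_real_activeBy (N := N) (S := S) v (t + 1)
  rw [Finset.sum_range_succ, ← LTMNetwork.law_real_activeBy, hN.law_real_activeBy hv,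
    hN.law_real_activeBy hv] at h1
  rw [← sub_eq_iff_eq_add'.2 h1, ← Finset.sum_sub_distrib]
  refine Finset.sum_congr rfl fun u hu => ?_
  rw [hN.law_real_metBy_succ (mem_inNbrs.1 hu)]
  ring

end LTMNetwork

namespace RealRAM

/-! ## Total correctness with a bound on the number of steps -/

/-- The program `p`, started in `s`, halts after at most `c` steps in a memory that satisfies `Q`. -/
def HaltsWithin (p : Prog) (s : Memory) (c : ℕ) (Q : Memory → Prop) : Prop :=
  ∃ k s', Exec p s k s' ∧ k ≤ c ∧ Q s'

namespace HaltsWithin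

variable {p q : Prog} {s : Memory} {c d e : ℕ} {Q R : Memory → Prop}

theorem mono (h : HaltsWithin p s c Q) (hcd : c ≤ d) (hQR : ∀ s', Q s' → R s') :
    HaltsWithin p s d R :=
  let ⟨k, s', h1, h2, h3⟩ := h
  ⟨k, s', h1, h2.trans hcd, hQR s' h3⟩

theorem skip (h : Q s) (hc : 1 ≤ c) : HaltsWithin .skip s c Q :=
  ⟨_, _, .skip s, hc, h⟩

theorem setNat {a : ℕ} {i x : NExpr} (h : Q (s.writeNat a (i.eval s) (x.eval s)))
    (hc : i.cost + x.cost + 1 ≤ c) : HaltsWithin (.setNat a i x) s c Q :=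
  ⟨_, _, .setNat s a i x, hc, h⟩

theorem setReal {a : ℕ} {i : NExpr} {x : RExpr} (h : Q (s.writeReal a (i.eval s) (x.eval s)))
    (hc : i.cost + x.cost + 1 ≤ c) : HaltsWithin (.setReal a i x) s c Q :=
  ⟨_, _, .setReal s a i x, hc, h⟩

theorem seq (c d : ℕ) (h : HaltsWithin p s c fun s' => HaltsWithin q s' d Q) (hc : c + d ≤ e) :
    HaltsWithin (.seq p q) s e Q :=
  let ⟨_, _, h1, h2, _, s', h4, h5, h6⟩ := h
  ⟨_, s', .seq h1 h4, (add_le_add h2 h5).trans hc, h6⟩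

theorem ifLt {x y : NExpr} (c : ℕ) (h1 : x.eval s < y.eval s → HaltsWithin p s c Q)
    (h2 : ¬ x.eval s < y.eval s → HaltsWithin q s c Q) (hc : x.cost + y.cost + 1 + c ≤ d) :
    HaltsWithin (.ifLt x y p q) s d Q := by
  by_cases h : x.eval s < y.eval s
  · obtain ⟨k, s', h3, h4, h5⟩ := h1 h
    exact ⟨_, s', .ifTrue h h3, (Nat.add_le_add_left h4 _).trans hc, h5⟩
  · obtain ⟨k, s', h3, h4, h5⟩ := h2 h
    exact ⟨_, s', .ifFalse h h3, (Nat.add_le_add_left h4 _).trans hc, h5⟩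

/-- A loop whose body is executed `m` times. -/
theorem whileLt {x y : NExpr} (Inv : ℕ → Memory → Prop) (m c : ℕ)
    (h0 : Inv 0 s)
    (hbody : ∀ i < m, ∀ s, Inv i s → x.eval s < y.eval s ∧ HaltsWithin p s c (Inv (i + 1)))
    (hend : ∀ s, Inv m s → ¬ x.eval s < y.eval s)
    (hc : m * (x.cost + y.cost + 1 + c) + (x.cost + y.cost + 1) ≤ d) :
    HaltsWithin (.whileLt x y p) s d (Inv m) := by
  -- Induction on the number `j` of iterations still to come.
  suffices H : ∀ j i s, i + j = m → Inv i s → HaltsWithin (.whileLt x y p) s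
      (j * (x.cost + y.cost + 1 + c) + (x.cost + y.cost + 1)) (Inv m) from
    (H m 0 s (by simp) h0).mono hc fun _ h => h
  intro j
  induction j with
  | zero =>
    rintro i s rfl hi
    exact ⟨_, s, .whileFalse (hend s hi), by simp, hi⟩
  | succ j ih =>
    intro i s hij hi
    obtain ⟨hlt, k, s', h1, h2, h3⟩ := hbody i (by omega) s hi
    obtain ⟨l, s'', h4, h5, h6⟩ := ih (i + 1) s' (by omega) h3
    refine ⟨_, s'', .whileTrue hlt h1 h4, ?_, h6⟩
    rw [Nat.add_mul, Nat.one_mul]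
    omega

end HaltsWithin

/-! ## The program -/

/-- Register `j` is entry `j` of the natural-number array `4`. -/
def reg (j : ℕ) : NExpr := .get 4 (.const j)

/-- Flag the seeds: they are activated at step `0`, and counted. -/
def seedBody : Prog :=
  .seq
    (.ifLt (.const 0) (.get 3 (reg 3))
      (.seq (.setReal 2 (reg 3) .one)
        (.setReal 3 (.const 0) (.add (.get 3 (.const 0)) .one)))
      .skip)
    (.setNat 4 (.const 3) (.add (reg 3) (.const 1)))

/-- Update the accumulator of the edge in register `3`, and add the weighted accumulator to the
activation probability of its head and to the influence spread, unless the head is a seed. -/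
def edgeBody : Prog :=
  .seq
    (.setReal 4 (reg 3) (.add (.mul (.sub .one (.get 1 (reg 3))) (.get 4 (reg 3)))
      (.mul (.get 1 (reg 3)) (.get 2 (.add (reg 1) (.get 1 (reg 3)))))))
    (.seq
      (.ifLt (.get 3 (.get 2 (reg 3))) (.const 1)
        (.seq
          (.setReal 2 (.add (reg 2) (.get 2 (reg 3)))
            (.add (.get 2 (.add (reg 2) (.get 2 (reg 3))))
              (.mul (.get 0 (reg 3)) (.get 4 (reg 3)))))
          (.setReal 3 (.const 0)
            (.add (.get 3 (.const 0)) (.mul (.get 0 (reg 3)) (.get 4 (reg 3))))))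
        .skip)
      (.setNat 4 (.const 3) (.add (reg 3) (.const 1))))

/-- One step of the diffusion. Registers `0`, `1` and `2` hold the number `t` of steps done and the
offsets of the activation probabilities at the steps `t` and `t + 1`. -/
def stepBody : Prog :=
  .seq (.setNat 4 (.const 3) (.const 0))
    (.seq (.whileLt (reg 3) (.get 0 (.const 1)) edgeBody)
      (.seq (.setNat 4 (.const 1) (reg 2))
        (.seq (.setNat 4 (.const 2) (.add (reg 2) (.get 0 (.const 0))))
          (.setNat 4 (.const 0) (.add (reg 0) (.const 1))))))

/-- The program that computes the activation probabilities and the influence spread. -/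
def spreadProg : Prog :=
  .seq (.whileLt (reg 3) (.get 0 (.const 0)) seedBody)
    (.seq (.setNat 4 (.const 2) (.get 0 (.const 0)))
      (.whileLt (reg 0) (.get 0 (.const 2)) stepBody))

/-! ## Its correctness -/

/-- The memories `s₀` and `s` agree on the input arrays. -/
structure SameInput (s₀ s : Memory) : Prop where
  nat : ∀ a < 4, s.nat a = s₀.nat a
  real0 : s.real 0 = s₀.real 0
  real1 : s.real 1 = s₀.real 1

/-- The recursion that is to be computed from the input in `s₀`, for the values `a t v` at the nodes
and the accumulators `c t e` at the edges. -/
structure IsSpread (s₀ : Memory) (a c : ℕ → ℕ → ℝ) : Prop where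
  head_lt : ∀ e < s₀.nat 0 1, s₀.nat 2 e < s₀.nat 0 0
  tail_lt : ∀ e < s₀.nat 0 1, s₀.nat 1 e < s₀.nat 0 0
  a_zero : ∀ v < s₀.nat 0 0, a 0 v = if 0 < s₀.nat 3 v then 1 else 0
  c_zero : ∀ e < s₀.nat 0 1, c 0 e = 0
  c_succ : ∀ t, ∀ e < s₀.nat 0 1, c (t + 1) e =
    (1 - s₀.real 1 e) * c t e + s₀.real 1 e * a t (s₀.nat 1 e)
  a_succ : ∀ t, ∀ v < s₀.nat 0 0, a (t + 1) v = ∑ e ∈ Finset.range (s₀.nat 0 1),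
    if s₀.nat 2 e = v ∧ s₀.nat 3 v < 1 then s₀.real 0 e * c (t + 1) e else 0

/-- The invariant of the loop over the seeds. -/
structure SeedInv (s₀ : Memory) (i : ℕ) (s : Memory) : Prop where
  same : SameInput s₀ s
  reg0 : s.nat 4 0 = 0
  reg1 : s.nat 4 1 = 0
  reg3 : s.nat 4 3 = i
  acc : ∀ e, s.real 4 e = 0
  val : ∀ j, s.real 2 j = if j < i ∧ 0 < s₀.nat 3 j then 1 else 0
  sum : s.real 3 0 = ∑ v ∈ Finset.range i, if 0 < s₀.nat 3 v then (1 : ℝ) else 0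

/-- The invariant of the loop over the steps. -/
structure StepInv (s₀ : Memory) (a c : ℕ → ℕ → ℝ) (t : ℕ) (s : Memory) : Prop where
  same : SameInput s₀ s
  reg0 : s.nat 4 0 = t
  reg1 : s.nat 4 1 = t * s₀.nat 0 0
  reg2 : s.nat 4 2 = (t + 1) * s₀.nat 0 0
  acc : ∀ e < s₀.nat 0 1, s.real 4 e = c t e
  val : ∀ r ≤ t, ∀ v < s₀.nat 0 0, s.real 2 (r * s₀.nat 0 0 + v) = a r v
  rest : ∀ j, (t + 1) * s₀.nat 0 0 ≤ j → s.real 2 j = 0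
  sum : s.real 3 0 = ∑ r ∈ Finset.range (t + 1), ∑ v ∈ Finset.range (s₀.nat 0 0), a r v

/-- The invariant of the loop over the edges at step `t + 1`. -/
structure EdgeInv (s₀ : Memory) (a c : ℕ → ℕ → ℝ) (t i : ℕ) (s : Memory) : Prop where
  same : SameInput s₀ s
  reg0 : s.nat 4 0 = t
  reg1 : s.nat 4 1 = t * s₀.nat 0 0
  reg2 : s.nat 4 2 = (t + 1) * s₀.nat 0 0
  reg3 : s.nat 4 3 = i
  acc : ∀ e < s₀.nat 0 1, s.real 4 e = if e < i then c (t + 1) e else c t e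
  val : ∀ r ≤ t, ∀ v < s₀.nat 0 0, s.real 2 (r * s₀.nat 0 0 + v) = a r v
  cur : ∀ v < s₀.nat 0 0, s.real 2 ((t + 1) * s₀.nat 0 0 + v) = ∑ e ∈ Finset.range i,
    if s₀.nat 2 e = v ∧ s₀.nat 3 v < 1 then s₀.real 0 e * c (t + 1) e else 0
  rest : ∀ j, (t + 2) * s₀.nat 0 0 ≤ j → s.real 2 j = 0
  sum : s.real 3 0 =
    (∑ r ∈ Finset.range (t + 1), ∑ v ∈ Finset.range (s₀.nat 0 0), a r v) +
      ∑ e ∈ Finset.range i,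
        if s₀.nat 3 (s₀.nat 2 e) < 1 then s₀.real 0 e * c (t + 1) e else 0

variable {s₀ s : Memory} {a c : ℕ → ℕ → ℝ} {t i : ℕ}

theorem SameInput.writeNat (h : SameInput s₀ s) (i k : ℕ) : SameInput s₀ (s.writeNat 4 i k) where
  nat b hb := by
    simpa [Memory.writeNat, Function.update_of_ne hb.ne] using h.nat b hb
  real0 := h.real0
  real1 := h.real1

theorem SameInput.writeReal (h : SameInput s₀ s) {b : ℕ} (hb : 2 ≤ b) (i : ℕ) (r : ℝ) :
    SameInput s₀ (s.writeReal b i r) where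
  nat := h.nat
  real0 := by
    simpa [Memory.writeReal, Function.update_of_ne (show 0 ≠ b by omega)] using h.real0
  real1 := by
    simpa [Memory.writeReal, Function.update_of_ne (show 1 ≠ b by omega)] using h.real1

theorem seedBody_haltsWithin (h : SeedInv s₀ i s) :
    HaltsWithin seedBody s 24 (SeedInv s₀ (i + 1)) := by
  have hs3 := h.same.nat 3 (by norm_num)
  -- The step budgets here and below are not tight; it matters only that one pass of a body without
  -- loops costs a constant.
  refine .seq 18 6 (.ifLt 12 (fun h1 => ?_) (fun h1 => ?_) (by decide)) le_rfl
  · refine .seq 4 6 (.setReal (.setReal (.setNat ?_ (by decide)) (by decide)) (by decide))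
      (by decide)
    simp only [NExpr.eval, reg, h.reg3, hs3] at h1
    refine ⟨((h.same.writeReal (by norm_num) _ _).writeReal (by norm_num) _ _).writeNat _ _,
      ?_, ?_, ?_, ?_, ?_, ?_⟩
    · simpa [Memory.writeNat, Memory.writeReal, NExpr.eval] using h.reg0
    · simpa [Memory.writeNat, Memory.writeReal, NExpr.eval] using h.reg1
    · simp [Memory.writeNat, Memory.writeReal, NExpr.eval, reg, h.reg3]
    · simpa [Memory.writeNat, Memory.writeReal] using h.acc
    · intro j
      simp only [Memory.writeNat, Memory.writeReal, NExpr.eval, RExpr.eval, reg, h.reg3]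
      rcases lt_trichotomy j i with hj | rfl | hj
      · simp [h.val, hj.ne, hj, hj.trans i.lt_succ_self]
      · simp [h1]
      · simp [h.val, hj.ne', hj.not_gt, show ¬ j < i + 1 by omega]
    · rw [Finset.sum_range_succ, if_pos h1, ← h.sum]
      simp [Memory.writeNat, Memory.writeReal, NExpr.eval, RExpr.eval]
  · refine .skip (.setNat ?_ (by decide)) (by decide)
    simp only [NExpr.eval, reg, h.reg3, hs3] at h1
    refine ⟨h.same.writeNat _ _, ?_, ?_, ?_, ?_, ?_, ?_⟩
    · simpa [Memory.writeNat, NExpr.eval] using h.reg0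
    · simpa [Memory.writeNat, NExpr.eval] using h.reg1
    · simp [Memory.writeNat, NExpr.eval, reg, h.reg3]
    · simpa [Memory.writeNat] using h.acc
    · intro j
      simp only [Memory.writeNat, h.val]
      rcases lt_trichotomy j i with hj | rfl | hj
      · simp [hj, hj.trans i.lt_succ_self]
      · simp [h1]
      · simp [hj.not_gt, show ¬ j < i + 1 by omega]
    · rw [Finset.sum_range_succ, if_neg h1, add_zero, ← h.sum]
      simp [Memory.writeNat]

theorem edgeBody_haltsWithin (hac : IsSpread s₀ a c) (h : EdgeInv s₀ a c t i s)
    (hi : i < s₀.nat 0 1) : HaltsWithin edgeBody s 100 (EdgeInv s₀ a c t (i + 1)) := by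
  have hs1 := h.same.nat 1 (by norm_num)
  have hs2 := h.same.nat 2 (by norm_num)
  have hs3 := h.same.nat 3 (by norm_num)
  have hacc : s.real 4 i = c t i := by simpa using h.acc i hi
  have hmul : (t + 1) * s₀.nat 0 0 = t * s₀.nat 0 0 + s₀.nat 0 0 := by ring
  have hmul2 : (t + 2) * s₀.nat 0 0 = t * s₀.nat 0 0 + s₀.nat 0 0 + s₀.nat 0 0 := by ring
  have hhead := hac.head_lt i hi
  refine .seq 30 70 (.setReal ?_ (by decide)) le_rfl
  have hx : ((RExpr.one.sub (.get 1 (reg 3))).mul (.get 4 (reg 3)) |>.add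
      ((RExpr.get 1 (reg 3)).mul (.get 2 ((reg 1).add (.get 1 (reg 3)))))).eval s =
      c (t + 1) i := by
    simp [RExpr.eval, NExpr.eval, reg, h.reg3, h.reg1, hacc, h.same.real1, hs1,
      h.val t le_rfl _ (hac.tail_lt i hi), hac.c_succ t i hi]
  have hi3 : (reg 3).eval s = i := h.reg3
  rw [hx, hi3]
  have hupd : ∀ e < s₀.nat 0 1, Function.update (s.real 4) i (c (t + 1) i) e =
      if e < i + 1 then c (t + 1) e else c t e := by
    intro e he
    rcases lt_trichotomy e i with hj | rfl | hj
    · simp [h.acc e he, hj.ne, hj, hj.trans i.lt_succ_self]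
    · simp
    · simp [h.acc e he, hj.ne', hj.not_gt, show ¬ e < i + 1 by omega]
  refine .seq 60 10 (.ifLt 50 (fun h1 => ?_) (fun h1 => ?_) (by decide)) le_rfl
  · refine .seq 25 25 (.setReal (.setReal (.setNat ?_ (by decide)) (by decide)) (by decide))
      (by decide)
    simp only [NExpr.eval, Memory.writeReal, reg, h.reg3, hs3, hs2] at h1
    refine ⟨(((h.same.writeReal (by norm_num) _ _).writeReal (by norm_num) _ _).writeReal
      (by norm_num) _ _).writeNat _ _, ?_, ?_, ?_, ?_, ?_, ?_, ?_, ?_, ?_⟩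
    · simpa [Memory.writeNat, Memory.writeReal, NExpr.eval] using h.reg0
    · simpa [Memory.writeNat, Memory.writeReal, NExpr.eval] using h.reg1
    · simpa [Memory.writeNat, Memory.writeReal, NExpr.eval] using h.reg2
    · simp [Memory.writeNat, Memory.writeReal, NExpr.eval, reg, h.reg3]
    · simpa [Memory.writeNat, Memory.writeReal] using hupd
    · intro r hr v hv
      have hle : r * s₀.nat 0 0 ≤ t * s₀.nat 0 0 := Nat.mul_le_mul_right _ hr
      -- Rows have width `n`, so the cell written in row `t + 1` lies beyond all earlier rows.
      have hne : r * s₀.nat 0 0 + v ≠ (t + 1) * s₀.nat 0 0 + s₀.nat 2 i := by omega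
      simpa [Memory.writeNat, Memory.writeReal, NExpr.eval, reg, h.reg3, h.reg2, hs2, hne]
        using h.val r hr v hv
    · intro v hv
      rw [Finset.sum_range_succ, ← h.cur v hv]
      by_cases hv' : s₀.nat 2 i = v
      · subst hv'
        simp [Memory.writeNat, Memory.writeReal, NExpr.eval, RExpr.eval, reg, h.reg3, h.reg2, hs2,
          h.same.real0, h1]
      · simp [Memory.writeNat, Memory.writeReal, NExpr.eval, reg, h.reg3, h.reg2, hs2, hv',
          Ne.symm hv']
    · intro j hj
      have hne : j ≠ (t + 1) * s₀.nat 0 0 + s₀.nat 2 i := by omega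
      simpa [Memory.writeNat, Memory.writeReal, NExpr.eval, reg, h.reg3, h.reg2, hs2, hne]
        using h.rest j hj
    · rw [Finset.sum_range_succ _ i, ← add_assoc, ← h.sum, if_pos h1]
      simp [Memory.writeNat, Memory.writeReal, NExpr.eval, RExpr.eval, reg, h.reg3, h.same.real0]
  · refine .skip (.setNat ?_ (by decide)) (by decide)
    simp only [NExpr.eval, Memory.writeReal, reg, h.reg3, hs3, hs2] at h1
    refine ⟨(h.same.writeReal (by norm_num) _ _).writeNat _ _, ?_, ?_, ?_, ?_, ?_, ?_, ?_, ?_, ?_⟩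
    · simpa [Memory.writeNat, Memory.writeReal, NExpr.eval] using h.reg0
    · simpa [Memory.writeNat, Memory.writeReal, NExpr.eval] using h.reg1
    · simpa [Memory.writeNat, Memory.writeReal, NExpr.eval] using h.reg2
    · simp [Memory.writeNat, Memory.writeReal, NExpr.eval, reg, h.reg3]
    · simpa [Memory.writeNat, Memory.writeReal] using hupd
    · simpa [Memory.writeNat, Memory.writeReal] using h.val
    · intro v hv
      rw [Finset.sum_range_succ, ← h.cur v hv, if_neg, add_zero]
      · simp [Memory.writeNat, Memory.writeReal]
      · rintro ⟨rfl, h2⟩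
        exact h1 h2
    · simpa [Memory.writeNat, Memory.writeReal] using h.rest
    · rw [Finset.sum_range_succ _ i, if_neg h1, add_zero, ← h.sum]
      simp [Memory.writeNat, Memory.writeReal]

theorem stepBody_haltsWithin (hac : IsSpread s₀ a c) (h : StepInv s₀ a c t s) :
    HaltsWithin stepBody s (s₀.nat 0 1 * 106 + 40) (StepInv s₀ a c (t + 1)) := by
  refine .seq 4 (s₀.nat 0 1 * 106 + 36) (.setNat ?_ (by decide)) (by omega)
  refine .seq (s₀.nat 0 1 * 106 + 6) 30 (.mono (.whileLt (EdgeInv s₀ a c t) (s₀.nat 0 1) 100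
    ?_ ?_ ?_ le_rfl)
    (by simp only [reg, NExpr.cost]; omega) ?_) (by omega)
  · refine ⟨h.same.writeNat _ _, ?_, ?_, ?_, ?_, ?_, ?_, ?_, ?_, ?_⟩
    · simpa [Memory.writeNat, NExpr.eval] using h.reg0
    · simpa [Memory.writeNat, NExpr.eval] using h.reg1
    · simpa [Memory.writeNat, NExpr.eval] using h.reg2
    · simp [Memory.writeNat, NExpr.eval]
    · simpa [Memory.writeNat] using h.acc
    · exact h.val
    -- Row `t + 1` is still zero, which is what the additions into it start from.
    · intro v hv
      exact h.rest _ (Nat.le_add_right _ _)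
    · intro j hj
      exact h.rest j (le_trans (Nat.mul_le_mul_right _ (by omega)) hj)
    · simpa [Memory.writeNat] using h.sum
  · intro i hi s hs
    refine ⟨?_, edgeBody_haltsWithin hac hs hi⟩
    simpa [NExpr.eval, reg, hs.reg3, hs.same.nat 0 (by norm_num)] using hi
  · intro s hs
    simp [NExpr.eval, reg, hs.reg3, hs.same.nat 0 (by norm_num)]
  · intro s hs
    refine .seq 10 20 (.setNat (.seq 10 10 (.setNat (.setNat ?_ (by decide)) (by decide))
      (by decide)) (by decide)) (by decide)
    have hs0 := hs.same.nat 0 (by norm_num)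
    refine ⟨((hs.same.writeNat _ _).writeNat _ _).writeNat _ _, ?_, ?_, ?_, ?_, ?_, ?_, ?_⟩
    · simp [Memory.writeNat, NExpr.eval, reg, hs.reg0]
    · simp [Memory.writeNat, NExpr.eval, reg, hs.reg2]
    · simp [Memory.writeNat, NExpr.eval, reg, hs.reg2, hs0]
      ring
    · intro e he
      exact (hs.acc e he).trans (if_pos he)
    · intro r hr v hv
      rcases Nat.le_succ_iff.1 hr with hr | rfl
      · exact hs.val r hr v hv
      · exact (hs.cur v hv).trans (hac.a_succ t v hv).symm
    · exact hs.rest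
    -- After exchanging the sums, each edge contributes at exactly one node, its head.
    · refine hs.sum.trans ?_
      rw [Finset.sum_range_succ _ (t + 1), add_right_inj,
        Finset.sum_congr rfl fun v hv => hac.a_succ t v (Finset.mem_range.1 hv), Finset.sum_comm]
      refine Finset.sum_congr rfl fun e he => ?_
      rw [Finset.sum_eq_single (s₀.nat 2 e)]
      · simp
      · intro v _ hv
        simp [hv.symm]
      · intro hv
        exact absurd (Finset.mem_range.2 (hac.head_lt e (Finset.mem_range.1 he))) hv

theorem spreadProg_haltsWithin (hac : IsSpread s₀ a c) (hreg : ∀ j, s₀.nat 4 j = 0)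
    (h2 : ∀ j, s₀.real 2 j = 0) (h3 : s₀.real 3 0 = 0) (h4 : ∀ j, s₀.real 4 j = 0) :
    HaltsWithin spreadProg s₀ (200 * (s₀.nat 0 2 + 1) * (s₀.nat 0 0 + s₀.nat 0 1 + 1))
      (StepInv s₀ a c (s₀.nat 0 2)) := by
  refine .seq (s₀.nat 0 0 * 30 + 6) (s₀.nat 0 2 * (s₀.nat 0 1 * 106 + 46) + 16)
    (.mono (.whileLt (SeedInv s₀) (s₀.nat 0 0) 24 ?_ ?_ ?_ le_rfl)
    (by simp only [reg, NExpr.cost]; omega) ?_) ?_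
  · exact ⟨⟨fun _ _ => rfl, rfl, rfl⟩, hreg 0, hreg 1, hreg 3, h4, by simpa using h2,
      by simpa using h3⟩
  · intro i hi s hs
    refine ⟨?_, seedBody_haltsWithin hs⟩
    simpa [NExpr.eval, reg, hs.reg3, hs.same.nat 0 (by norm_num)] using hi
  · intro s hs
    simp [NExpr.eval, reg, hs.reg3, hs.same.nat 0 (by norm_num)]
  · intro s hs
    have hs0 := hs.same.nat 0 (by norm_num)
    -- Register 2 becomes `n`, the offset of row 1; later offsets arise by adding `n`, as indices
    -- cannot be multiplied.
    refine .seq 10 (s₀.nat 0 2 * (s₀.nat 0 1 * 106 + 46) + 6) (.setNat ?_ (by decide)) (by omega)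
    refine .whileLt (StepInv s₀ a c) (s₀.nat 0 2) (s₀.nat 0 1 * 106 + 40) ?_ ?_ ?_ ?_
    · refine ⟨hs.same.writeNat _ _, ?_, ?_, ?_, ?_, ?_, ?_, ?_⟩
      · simpa [Memory.writeNat, NExpr.eval] using hs.reg0
      · simpa [Memory.writeNat, NExpr.eval] using hs.reg1
      · simp [Memory.writeNat, NExpr.eval, hs0]
      · intro e he
        exact (hs.acc e).trans (hac.c_zero e he).symm
      · intro r hr v hv
        obtain rfl := Nat.le_zero.1 hr
        rw [hac.a_zero v hv]
        simpa [Memory.writeNat, hv] using hs.val v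
      · intro j hj
        have : ¬ j < s₀.nat 0 0 := by omega
        simpa [Memory.writeNat, this] using hs.val j
      · refine hs.sum.trans ?_
        rw [zero_add, Finset.sum_range_one]
        exact Finset.sum_congr rfl fun v hv => (hac.a_zero v (Finset.mem_range.1 hv)).symm
    · intro i hi s hs
      refine ⟨?_, stepBody_haltsWithin hac hs⟩
      simpa [NExpr.eval, reg, hs.reg0, hs.same.nat 0 (by norm_num)] using hi
    · intro s hs
      simp [NExpr.eval, reg, hs.reg0, hs.same.nat 0 (by norm_num)]
    · simp only [reg, NExpr.cost]
      ring_nf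
      omega
  -- Expanding leaves `τ * n` and `τ * m` as atoms, so that the comparison is linear.
  · generalize s₀.nat 0 2 = τ
    generalize s₀.nat 0 0 = n
    generalize s₀.nat 0 1 = m
    have h1 : 200 * (τ + 1) * (n + m + 1) =
        200 * (τ * n) + 200 * (τ * m) + 200 * τ + 200 * n + 200 * m + 200 := by ring
    have h2 : τ * (m * 106 + 46) = 106 * (τ * m) + 46 * τ := by ring
    omega

end RealRAM

namespace LTMNetwork

/-! ## The recursion along the list of edges -/

/-- The factor of `b u v` in the recursion for the activation probability of `v` at step `t`. -/
noncomputable def edgeAcc {V : Type*} [Fintype V] [DecidableEq V] (N : LTMNetwork V)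
    (S : Finset V) (t : ℕ) (e : V × V) : ℝ :=
  ∑ s ∈ Finset.range t, N.ap S e.1 s * (N.m e.1 e.2 : ℝ) * (1 - (N.m e.1 e.2 : ℝ)) ^ (t - s - 1)

/-- Every old term gains a factor `1 - m` and the new one has exponent 0. This avoids recomputing
the sum and keeps the running time linear in the deadline. -/
theorem edgeAcc_succ {V : Type*} [Fintype V] [DecidableEq V] (N : LTMNetwork V)
    (S : Finset V) (t : ℕ) (e : V × V) :
    N.edgeAcc S (t + 1) e =
      (1 - (N.m e.1 e.2 : ℝ)) * N.edgeAcc S t e + (N.m e.1 e.2 : ℝ) * N.ap S e.1 t := by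
  rw [edgeAcc, Finset.sum_range_succ, edgeAcc, Finset.mul_sum]
  congr 1
  · refine Finset.sum_congr rfl fun s hs => ?_
    have hs := Finset.mem_range.1 hs
    rw [show t + 1 - s - 1 = t - s - 1 + 1 by omega, pow_succ]
    ring
  · simp [mul_comm]

theorem IsAcyclic.ap_eq_sum_edgeAcc {V : Type*} [Fintype V] [DecidableEq V] {N : LTMNetwork V}
    (hN : N.IsAcyclic) {S : Finset V} {v : V} (hv : v ∉ S) {t : ℕ} (ht : 1 ≤ t) :
    N.ap S v t = ∑ u ∈ N.inNbrs v, N.b u v * N.edgeAcc S t (u, v) := by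
  obtain ⟨t, rfl⟩ := Nat.exists_eq_add_of_le' ht
  rw [hN.ap_succ hv]
  refine Finset.sum_congr rfl fun u _ => congrArg _ (Finset.sum_congr rfl fun s _ => ?_)
  rw [show t + 1 - s - 1 = t - s by omega]

/-- Edges with head `v` correspond to in-neighbours through their tails, and a list without
repetitions counts each once. -/
theorem sum_range_edges {V M : Type*} [Fintype V] [DecidableEq V] [AddCommMonoid M]
    (N : LTMNetwork V) {es : List (V × V)} (hnd : es.Nodup) (hes : ∀ e, e ∈ es ↔ e ∈ N.E)
    {f : ℕ → M} {g : V → M} {v : V}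
    (hf : ∀ i (h : i < es.length), f i = if es[i].2 = v then g es[i].1 else 0) :
    ∑ i ∈ Finset.range es.length, f i = ∑ u ∈ N.inNbrs v, g u := by
  have hE : es.toFinset = N.E := by ext e; simp [hes]
  rw [Finset.sum_range, Finset.sum_congr rfl fun (i : Fin es.length) _ => hf i i.2]
  have h1 := Fin.sum_univ_fun_getElem es fun e => if e.2 = v then g e.1 else 0
  rw [h1, ← List.sum_toFinset _ hnd, hE, ← Finset.sum_filter]
  refine Finset.sum_nbij' Prod.fst (fun u => (u, v)) ?_ ?_ ?_ ?_ ?_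
  · rintro ⟨x, y⟩ h
    obtain ⟨hE, rfl⟩ := Finset.mem_filter.1 h
    exact mem_inNbrs.2 hE
  · intro u hu
    exact Finset.mem_filter.2 ⟨mem_inNbrs.1 hu, rfl⟩
  · rintro ⟨x, y⟩ h
    obtain ⟨-, rfl⟩ := Finset.mem_filter.1 h
    rfl
  · intro u _
    rfl
  · intro e _
    rfl

variable {n : ℕ} {N : LTMNetwork (Fin n)} {S : Finset (Fin n)} {es : List (Fin n × Fin n)}
  {τ : ℕ}

theorem IsAcyclic.isSpread_input (hN : N.IsAcyclic) (hnd : es.Nodup)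
    (hes : ∀ e, e ∈ es ↔ e ∈ N.E) :
    RealRAM.IsSpread (N.input S es τ) (fun t v => if h : v < n then N.ap S ⟨v, h⟩ t else 0)
      (fun t e => if h : e < es.length then N.edgeAcc S t es[e] else 0) where
  head_lt e he := by
    have he : e < es.length := he
    simp [input, he]
  tail_lt e he := by
    have he : e < es.length := he
    simp [input, he]
  a_zero v hv := by
    have hv : v < n := hv
    by_cases h : (⟨v, hv⟩ : Fin n) ∈ S <;> simp [input, hv, ap_zero, h]
  c_zero e he := by simp [edgeAcc]
  c_succ t e he := by
    have he : e < es.length := he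
    simp [input, he, edgeAcc_succ]
  a_succ t v hv := by
    have hv : v < n := hv
    -- At a seed the recursion of the theorem is not available: the flag suppresses every
    -- contribution, matching the value 0 after step 0.
    by_cases h : (⟨v, hv⟩ : Fin n) ∈ S
    · simp [input, hv, h, ap_succ_of_mem h]
    · rw [dif_pos hv, hN.ap_eq_sum_edgeAcc h t.succ_pos]
      refine (N.sum_range_edges hnd hes fun i hi => ?_).symm
      by_cases h2 : es[i].2 = ⟨v, hv⟩
      · have h3 : es[i] = (es[i].1, ⟨v, hv⟩) := Prod.ext rfl h2
        have h4 : (es[i].2 : ℕ) = v := congrArg Fin.val h2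
        rw [if_pos h2, ← h3]
        simp [input, hi, hv, h, h2]
      · have h4 : (es[i].2 : ℕ) ≠ v := fun h => h2 (Fin.ext h)
        simp [input, hi, h2, h4]

end LTMNetwork

theorem mainTheorem4 :
    -- the recursion for the activation probabilities in a DAG
    (∀ (V : Type*) [Fintype V] [DecidableEq V] (N : LTMNetwork V), N.IsAcyclic →
      ∀ (S : Finset V) (τ t : ℕ) (v : V), v ∉ S → 1 ≤ t → t ≤ τ →
        N.ap S v t = ∑ u ∈ N.inNbrs v, N.b u v *
          ∑ t' ∈ Finset.range t,
            N.ap S u t' * (N.m u v : ℝ) * (1 - (N.m u v : ℝ)) ^ (t - t' - 1)) ∧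
    -- one program computes all activation probabilities up to the deadline, and the influence
    -- spread, exactly, in time linear in the size of the graph
    (∃ (P : RealRAM.Prog) (C : ℕ), ∀ (n : ℕ) (N : LTMNetwork (Fin n)), N.IsAcyclic →
      ∀ (S : Finset (Fin n)) (es : List (Fin n × Fin n)), es.Nodup → (∀ e, e ∈ es ↔ e ∈ N.E) →
        ∀ τ : ℕ, ∃ (k : ℕ) (s : RealRAM.Memory),
          RealRAM.Exec P (N.input S es τ) k s ∧
          k ≤ C * (τ + 1) * (n + N.E.card + 1) ∧
          (∀ (v : Fin n) (t : ℕ), t ≤ τ → s.real 2 (t * n + v) = N.ap S v t) ∧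
          s.real 3 0 = N.influence S τ) := by
  refine ⟨fun V _ _ N hN S τ t v hv ht _ => hN.ap_eq_sum_edgeAcc hv ht, RealRAM.spreadProg, 200,
    fun n N hN S es hnd hes τ => ?_⟩
  have hcard : N.E.card = es.length := by
    rw [← List.toFinset_card_of_nodup hnd]
    congr 1
    ext e
    simp [hes]
  obtain ⟨k, s, h1, h2, h3⟩ := RealRAM.spreadProg_haltsWithin
    (hN.isSpread_input (S := S) (τ := τ) hnd hes) (fun _ => rfl) (fun _ => rfl) rfl (fun _ => rfl)
  refine ⟨k, s, h1, ?_, fun v t ht => ?_, ?_⟩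
  · rw [hcard]
    exact h2
  · refine (h3.val t ht v v.2).trans ?_
    rw [dif_pos v.2]
  · refine h3.sum.trans ?_
    rw [LTMNetwork.influence_eq_sum_ap]
    refine Finset.sum_congr rfl fun t _ => ?_
    exact (Finset.sum_range _).trans (Finset.sum_congr rfl fun v _ => dif_pos v.2)
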